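/- Let $k>0$ be real. All integrals below converge absolutely. (i) Let $\alpha,\beta,\gamma,s$ be real, $\gamma\notin\{0,-1,-2,\dots\}$, and $0<\frac sk<\min(\alpha,\beta)$. Then $$\int_0^\infty x^{s-1}F\Bigl(\alpha,\beta,\gamma,-\frac{x^k}{k}\Bigr)dx=k^{\frac sk-1}\,\Gamma\Bigl(\frac sk\Bigr)\frac{\Gamma(\gamma)}{\Gamma(\alpha)\Gamma(\beta)}\,\frac{\Gamma\bigl(\alpha-\frac sk\bigr)\Gamma\bigl(\beta-\frac sk\bigr)}{\Gamma\bigl(\gamma-\frac sk\bigr)},$$ where $F(\alpha,\beta,\gamma,x)$ is the hypergeometric function, defined for $|x|<1$ by the usual power series $\sum_{r\ge0}\frac{(\alpha)_r(\beta)_r}{(\gamma)_r}\frac{x^r}{r!}$ and for $x\le-1$ by (real-)analytic continuation to $(-\infty,1)$, which exists; $1/\Gamma$ is read as $0$ at the poles of $\Gamma$. (ii) Let $m,s$ be real and $0<\frac sk<1$. Then the following series converges for every $x>0$ and $$\int_0^\infty x^{s-1}\sum_{r=0}^\infty\frac{(r+1)^m(-1)^r x^{kr}}{r!\,k^r}\,dx=k^{\frac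 sk-1}\,\Gamma\Bigl(\frac sk\Bigr)\Bigl(1-\frac sk\Bigr)^m .$$ (iii) Let $s$ be real and $0<\frac sk<\frac12$. Then, with $\zeta$ the Riemann zeta function, the following series converges for every $x>0$ and $$\int_0^\infty x^{s-1}\sum_{r=0}^\infty\frac{(-1)^r x^{kr}}{r!\,k^r\,\zeta(2r+2)}\,dx=\frac{k^{\frac sk-1}\,\Gamma\bigl(\frac sk\bigr)}{\zeta\bigl(2-\frac{2s}{k}\bigr)} .$$ (iv) Let $m,s$ be real and $0<\frac sk<m$. Then $$\int_0^\infty x^{s-1}\Bigl(1+\frac{x^k}{k}\Bigr)^{-m}dx=\frac{k^{\frac sk-1}\,\Gamma\bigl(\frac sk\bigr)\,\Gamma\bigl(m-\frac sk\bigr)}{\Gamma(m)} .$$ -/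

import Mathlib

/-- `IsGaussContinuation a b c F` says that, on the real half-line `(-∞, 1)`, the function `F` is
the analytic continuation of the Gauss hypergeometric power series
`∑ (a)_n (b)_n / (c)_n * x ^ n / n!`: it is real-analytic on `(-∞, 1)` and is the sum of the
series on the interval of convergence `(-1, 1)`.  Two such functions agree on `(-∞, 1)`. -/
def IsGaussContinuation (a b c : ℝ) (F : ℝ → ℝ) : Prop :=
  AnalyticOnNhd ℝ F (Set.Iio 1) ∧
    ∀ x ∈ Set.Ioo (-1 : ℝ) 1,
      HasSum (fun n : ℕ => (ascPochhammer ℝ n).eval a * (ascPochhammer ℝ n).eval b /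
        (ascPochhammer ℝ n).eval c * (x ^ n / (n.factorial : ℝ))) (F x)

open Classical in
/-- The Gauss hypergeometric function `F(a, b, c, x)` for real `x < 1`: the power series for
`-1 < x < 1`, and its analytic continuation for `x ≤ -1`.  (The value is immaterial where no
continuation exists, i.e. where `c` is a pole, and for `x ≥ 1`.) -/
noncomputable def gaussF (a b c : ℝ) : ℝ → ℝ :=
  if h : ∃ F : ℝ → ℝ, IsGaussContinuation a b c F then Classical.choose h else fun _ => 0

/-! The substitution `y = x ^ k / k` turns every integral into a Mellin transform at `s / k`, with
factor `k ^ (s / k - 1)`. After that, one mechanism does the work: for a superposition of dilates `∫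
c t * g (y * w t)`, the `r`-th power series coefficient of `g` is multiplied by the moment `∫ c * w
^ r` (`hasSum_mul_integral_of_hasSum_pow`), and its Mellin transform at `s` by the same moment
function at `-s` (`HasRealMellin.integral_mul_comp_mul`, by Fubini). This is Ramanujan's master
theorem for coefficients that are moments. Starting from `exp (-y)`, with transform `Γ(s)`, Gamma
densities give `(1 + y) ^ (-m)` and the factors `(r + 1) ^ (m - n)`, and the Möbius series gives `1
/ ζ(2r + 2)`. Starting from `(1 + y) ^ (-a)`, the Beta density gives Euler's integral for `F` when
`b < c`; a contiguous relation removes that restriction. -/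

section

open MeasureTheory Set

/-- The Mellin transform of the real function `g` converges absolutely at `s`, with value `v`. -/
def HasRealMellin (g : ℝ → ℝ) (s v : ℝ) : Prop :=
  IntegrableOn (fun x : ℝ => x ^ (s - 1) * g x) (Ioi 0) ∧
    ∫ x in Ioi (0 : ℝ), x ^ (s - 1) * g x = v

/-! ### Calculus of real Mellin transforms. -/

namespace HasRealMellin

variable {f g : ℝ → ℝ} {s v w : ℝ}

theorem congr (hf : HasRealMellin f s v) (h : EqOn f g (Ioi 0)) : HasRealMellin g s v := by
  have h' : EqOn (fun x : ℝ => x ^ (s - 1) * f x) (fun x : ℝ => x ^ (s - 1) * g x) (Ioi 0) :=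
    fun x hx => by simp only [h hx]
  exact ⟨hf.1.congr_fun h' measurableSet_Ioi,
    by rw [← setIntegral_congr_fun measurableSet_Ioi h']; exact hf.2⟩

/-- A factor `y` shifts `s` by one. Both inductions below, on the exponent and on the contiguous
relation, rest on this. -/
theorem const_mul_add_const_mul_id_mul (a b : ℝ) (hf : HasRealMellin f s v)
    (hg : HasRealMellin g (s + 1) w) :
    HasRealMellin (fun y => a * f y + b * (y * g y)) s (a * v + b * w) := by
  have h : EqOn (fun x : ℝ => a * (x ^ (s - 1) * f x) + b * (x ^ (s + 1 - 1) * g x))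
      (fun x : ℝ => x ^ (s - 1) * (a * f x + b * (x * g x))) (Ioi 0) := fun x hx => by
    have : x ^ (s + 1 - 1) = x ^ (s - 1) * x := by
      rw [← Real.rpow_add_one (ne_of_gt hx)]; ring_nf
    simp only [this]; ring
  refine ⟨IntegrableOn.congr_fun ((hf.1.const_mul a).add (hg.1.const_mul b)) h
    measurableSet_Ioi, ?_⟩
  rw [← setIntegral_congr_fun measurableSet_Ioi h,
    integral_add (hf.1.const_mul a) (hg.1.const_mul b), integral_const_mul, integral_const_mul,
    hf.2, hg.2]

theorem comp_mul_right (hf : HasRealMellin f s v) {a : ℝ} (ha : 0 < a) :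
    HasRealMellin (fun y => f (y * a)) s (a ^ (-s) * v) := by
  have h : EqOn (fun x : ℝ => a ^ (1 - s) * ((x * a) ^ (s - 1) * f (x * a)))
      (fun x : ℝ => x ^ (s - 1) * f (x * a)) (Ioi 0) := fun x hx => by
    have hx : 0 < x := hx
    have : a ^ (1 - s) * a ^ (s - 1) = 1 := by rw [← Real.rpow_add ha]; simp
    simp only [Real.mul_rpow hx.le ha.le]
    linear_combination (x ^ (s - 1) * f (x * a)) * this
  constructor
  · refine IntegrableOn.congr_fun (Integrable.const_mul ?_ _) h measurableSet_Ioi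
    refine (integrableOn_Ioi_comp_mul_right_iff (fun x => x ^ (s - 1) * f x) 0 ha).2 ?_
    simpa using hf.1
  · rw [← setIntegral_congr_fun measurableSet_Ioi h, integral_const_mul,
      integral_comp_mul_right_Ioi (fun x => x ^ (s - 1) * f x) 0 ha, zero_mul, hf.2, smul_eq_mul,
      ← mul_assoc, show (1 - s) = -s + 1 by ring, Real.rpow_add_one ha.ne', mul_assoc (a ^ (-s)),
      mul_inv_cancel₀ ha.ne', mul_one]

theorem comp_rpow_div {k : ℝ} (hk : 0 < k) (hf : HasRealMellin f (s / k) v) :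
    HasRealMellin (fun x => f (x ^ k / k)) s (k ^ (s / k - 1) * v) := by
  have hf' := hf.comp_mul_right (inv_pos.2 hk)
  have h : EqOn (fun x : ℝ => k⁻¹ * ((k * x ^ (k - 1)) • ((x ^ k) ^ (s / k - 1) * f (x ^ k * k⁻¹))))
      (fun x : ℝ => x ^ (s - 1) * f (x ^ k / k)) (Ioi 0) := fun x hx => by
    have hx : 0 < x := hx
    have : x ^ (s - 1) = x ^ (k - 1) * (x ^ k) ^ (s / k - 1) := by
      rw [← Real.rpow_mul hx.le, ← Real.rpow_add hx]
      congr 1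
      field_simp
      ring
    simp only [this, smul_eq_mul, div_eq_mul_inv]
    field_simp
  constructor
  · refine IntegrableOn.congr_fun (Integrable.const_mul ?_ _) h measurableSet_Ioi
    have := (integrableOn_Ioi_comp_rpow_iff _ hk.ne').2 hf'.1
    rwa [abs_of_pos hk] at this
  · rw [← setIntegral_congr_fun measurableSet_Ioi h, integral_const_mul,
      integral_comp_rpow_Ioi_of_pos (g := fun y => y ^ (s / k - 1) * f (y * k⁻¹)) hk, hf'.2,
      Real.inv_rpow hk.le, Real.rpow_neg hk.le, inv_inv, Real.rpow_sub_one hk.ne']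
    ring

/-- The Mellin transform of a superposition of dilates. -/
theorem integral_mul_comp_mul {T : Type*} [MeasurableSpace T] {μ : Measure T} [SFinite μ]
    {c w : T → ℝ} (hg : Measurable g) (hc : Measurable c) (hw : Measurable w)
    (hw0 : ∀ᵐ t ∂μ, 0 < w t) (hM : HasRealMellin g s v)
    (hcw : Integrable (fun t => c t * w t ^ (-s)) μ) :
    HasRealMellin (fun y => ∫ t, c t * g (y * w t) ∂μ) s (v * ∫ t, c t * w t ^ (-s) ∂μ) := by
  let F : ℝ → T → ℝ := fun y t => y ^ (s - 1) * (c t * g (y * w t))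
  have hF : Measurable (Function.uncurry F) := by
    unfold F Function.uncurry
    fun_prop
  -- Fubini needs the norm of the integrand; scaling `|g|` shows that its inner integral is a
  -- constant times `|c t| * w t ^ (-s)`.
  have hM' : HasRealMellin (fun y => |g y|) s (∫ x in Ioi (0 : ℝ), x ^ (s - 1) * |g x|) := by
    refine ⟨?_, rfl⟩
    refine IntegrableOn.congr_fun hM.1.abs (fun x hx => ?_) measurableSet_Ioi
    have : 0 ≤ x ^ (s - 1) := Real.rpow_nonneg (le_of_lt hx) _
    simp [abs_mul, abs_of_nonneg this]
  have hint : Integrable (Function.uncurry F) ((volume.restrict (Ioi 0)).prod μ) := by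
    rw [integrable_prod_iff' hF.aestronglyMeasurable]
    constructor
    · filter_upwards [hw0] with t ht
      refine ((hM.comp_mul_right ht).1.const_mul (c t)).congr (.of_forall fun y => ?_)
      simp only [Function.uncurry, F]
      ring
    · refine (hcw.abs.mul_const (∫ x in Ioi (0 : ℝ), x ^ (s - 1) * |g x|)).congr ?_
      filter_upwards [hw0] with t ht
      have h := (hM'.comp_mul_right ht).2
      have e : EqOn (fun y => |c t| * (y ^ (s - 1) * |g (y * w t)|))
          (fun y => ‖Function.uncurry F (y, t)‖) (Ioi 0) := fun y hy => by
        have : 0 ≤ y ^ (s - 1) := Real.rpow_nonneg (le_of_lt hy) _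
        simp only [Function.uncurry, F, Real.norm_eq_abs, abs_mul, abs_of_nonneg this]
        ring
      rw [← setIntegral_congr_fun measurableSet_Ioi e, integral_const_mul, h, abs_mul,
        abs_of_nonneg (Real.rpow_nonneg ht.le _)]
      ring
  constructor
  · refine hint.integral_prod_left.congr (.of_forall fun y => ?_)
    simp only [Function.uncurry, F, integral_const_mul]
  · have := integral_integral_swap hint
    simp only [F, integral_const_mul] at this
    rw [this, ← integral_const_mul]
    refine integral_congr_ae ?_
    filter_upwards [hw0] with t ht
    have h := (hM.comp_mul_right ht).2
    have e : ∀ y, y ^ (s - 1) * (c t * g (y * w t)) = c t * (y ^ (s - 1) * g (y * w t)) :=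
      fun y => by ring
    simp only [e, integral_const_mul, h]
    ring

end HasRealMellin

/-! ### The exponential and the binomial. -/

theorem hasRealMellin_exp_neg {s : ℝ} (hs : 0 < s) :
    HasRealMellin (fun y => Real.exp (-y)) s (Real.Gamma s) := by
  have h : ∀ x : ℝ, x ^ (s - 1) * Real.exp (-x) = Real.exp (-x) * x ^ (s - 1) :=
    fun x => mul_comm _ _
  constructor
  · simpa only [h] using Real.GammaIntegral_convergent hs
  · simpa only [h] using (Real.Gamma_eq_integral hs).symm

theorem integrableOn_rpow_mul_exp_neg_mul {a r : ℝ} (ha : 0 < a) (hr : 0 < r) :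
    IntegrableOn (fun t => t ^ (a - 1) * Real.exp (-(r * t))) (Ioi 0) := by
  simpa only [mul_comm] using ((hasRealMellin_exp_neg ha).comp_mul_right hr).1

/-- `(1 + y) ^ (-m)` is the Laplace transform of the Gamma density of parameter `m`, hence a
superposition of the dilates `exp (-(y * t))`. -/
theorem hasRealMellin_one_add_rpow_neg {m s : ℝ} (hs : 0 < s) (hm : s < m) :
    HasRealMellin (fun y => (1 + y) ^ (-m)) s
      (Real.Gamma s * (Real.Gamma (m - s) / Real.Gamma m)) := by
  have hm0 : 0 < m := hs.trans hm
  have hG : Real.Gamma m ≠ 0 := (Real.Gamma_pos_of_pos hm0).ne'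
  let c : ℝ → ℝ := fun t => t ^ (m - 1) * Real.exp (-t) / Real.Gamma m
  have e : EqOn (fun t => t ^ (m - s - 1) * Real.exp (-(1 * t)) / Real.Gamma m)
      (fun t => c t * t ^ (-s)) (Ioi 0) := fun t ht => by
    have ht : 0 < t := ht
    have : t ^ (m - s - 1) = t ^ (m - 1) * t ^ (-s) := by rw [← Real.rpow_add ht]; ring_nf
    simp only [c, this, one_mul]
    ring
  have key := HasRealMellin.integral_mul_comp_mul (μ := volume.restrict (Ioi (0 : ℝ))) (c := c)
    (w := fun t => t) (g := fun y => Real.exp (-y)) (by fun_prop) (by fun_prop) (by fun_prop)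
    (ae_restrict_mem measurableSet_Ioi) (hasRealMellin_exp_neg hs)
    (IntegrableOn.congr_fun
      ((integrableOn_rpow_mul_exp_neg_mul (sub_pos.2 hm) one_pos).div_const _) e measurableSet_Ioi)
  rw [← setIntegral_congr_fun measurableSet_Ioi e, integral_div,
    Real.integral_rpow_mul_exp_neg_mul_Ioi (sub_pos.2 hm) one_pos] at key
  simp only [div_one, Real.one_rpow, one_mul] at key
  refine key.congr fun y hy => ?_
  have hy : 0 < y := hy
  have h1 : 0 < 1 + y := by positivity
  have e2 : ∀ t, c t * Real.exp (-(y * t)) =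
      t ^ (m - 1) * Real.exp (-((1 + y) * t)) / Real.Gamma m := fun t => by
    have : Real.exp (-((1 + y) * t)) = Real.exp (-t) * Real.exp (-(y * t)) := by
      rw [← Real.exp_add]; ring_nf
    simp only [c, this]
    ring
  simp only [e2]
  rw [integral_div, Real.integral_rpow_mul_exp_neg_mul_Ioi hm0 h1, mul_div_assoc, div_self hG,
    mul_one, one_div, Real.inv_rpow h1.le, Real.rpow_neg h1.le]

/-! ### Power series under superposition, and the coefficients `(r + 1) ^ m / r!`. -/

/-- Termwise integration of a power series along a bounded dilation. -/
theorem hasSum_mul_integral_of_hasSum_pow {T : Type*} [MeasurableSpace T] {μ : Measure T}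
    {c w : T → ℝ} {a : ℕ → ℝ} {g : ℝ → ℝ} {x : ℝ} (hc : Integrable c μ) (hw : Measurable w)
    (hw0 : ∀ᵐ t ∂μ, w t ∈ Icc (0 : ℝ) 1) (ha : Summable fun r => |a r * x ^ r|)
    (hg : ∀ᵐ t ∂μ, HasSum (fun r => a r * (x * w t) ^ r) (g (x * w t))) :
    HasSum (fun r => a r * x ^ r * ∫ t, c t * w t ^ r ∂μ) (∫ t, c t * g (x * w t) ∂μ) := by
  have hi : ∀ r : ℕ, Integrable (fun t => c t * w t ^ r) μ := fun r => by
    refine hc.norm.mono' (hc.1.mul (by fun_prop)) ?_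
    filter_upwards [hw0] with t ht
    rw [norm_mul, norm_pow, Real.norm_of_nonneg ht.1]
    exact mul_le_of_le_one_right (norm_nonneg _) (pow_le_one₀ ht.1 ht.2)
  have key := hasSum_integral_of_summable_integral_norm
    (F := fun (r : ℕ) t => a r * x ^ r * (c t * w t ^ r)) (fun r => (hi r).const_mul _) (by
      refine Summable.of_nonneg_of_le (fun r => ?_) (fun r => ?_) (ha.mul_right (∫ t, ‖c t‖ ∂μ))
      · exact integral_nonneg fun t => norm_nonneg _
      simp only [norm_mul (a r * x ^ r), integral_const_mul, Real.norm_eq_abs (a r * x ^ r)]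
      refine mul_le_mul_of_nonneg_left (integral_mono_ae (hi r).norm hc.norm ?_) (abs_nonneg _)
      filter_upwards [hw0] with t ht
      rw [norm_mul, norm_pow, Real.norm_of_nonneg ht.1]
      exact mul_le_of_le_one_right (norm_nonneg _) (pow_le_one₀ ht.1 ht.2))
  simp only [integral_const_mul] at key
  have e : ∫ t, ∑' r, a r * x ^ r * (c t * w t ^ r) ∂μ = ∫ t, c t * g (x * w t) ∂μ := by
    refine integral_congr_ae ?_
    filter_upwards [hg] with t ht
    rw [← ht.tsum_eq, ← tsum_mul_left]
    exact tsum_congr fun r => by rw [mul_pow]; ring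
  rwa [e] at key

/-- Split one factor `r + j + 1` as `(j + 1) + r`; cancelling `r` against `r!` shifts the index,
which replaces `j` by `j + 1`. Hence the induction must keep `j` free. -/
theorem exists_hasRealMellin_natPow_mul_exp_series (n : ℕ) : ∀ j : ℕ, ∃ g : ℝ → ℝ, Measurable g ∧
    (∀ y, HasSum (fun r : ℕ => ((r : ℝ) + j + 1) ^ n / r.factorial * y ^ r) (g (-y))) ∧
    ∀ s : ℝ, 0 < s → HasRealMellin g s (Real.Gamma s * (j + 1 - s) ^ n) := by
  induction n with
  | zero =>
    refine fun j => ⟨fun y => Real.exp (-y), by fun_prop, fun y => ?_, fun s hs => ?_⟩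
    · have := NormedSpace.expSeries_div_hasSum_exp (𝔸 := ℝ) y
      rw [← Real.exp_eq_exp_ℝ] at this
      simp only [neg_neg, pow_zero]
      refine this.congr_fun fun r => ?_
      ring
    · simpa using hasRealMellin_exp_neg hs
  | succ n ih =>
    intro j
    obtain ⟨g, hgm, hgs, hgM⟩ := ih j
    obtain ⟨h, hhm, hhs, hhM⟩ := ih (j + 1)
    refine ⟨fun y => (j + 1) * g y + (-1) * (y * h y), by fun_prop, fun y => ?_, fun s hs => ?_⟩
    · have h1 : HasSum (fun r : ℕ => (r : ℝ) * (((r : ℝ) + j + 1) ^ n / r.factorial * y ^ r))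
          (y * h (-y)) := by
        rw [← hasSum_nat_add_iff' 1]
        simp only [Finset.sum_range_one, Nat.cast_zero, zero_mul, sub_zero]
        refine ((hhs y).mul_left y).congr_fun fun r => ?_
        rw [Nat.factorial_succ]
        have : (r.factorial : ℝ) ≠ 0 := by positivity
        push_cast
        field_simp
        ring
      have := ((hgs y).mul_left ((j : ℝ) + 1)).add h1
      beta_reduce
      rw [show ((j : ℝ) + 1) * g (-y) + -1 * (-y * h (-y)) = (j + 1) * g (-y) + y * h (-y) by ring]
      refine this.congr_fun fun r => ?_
      ring
    · convert (hgM s hs).const_mul_add_const_mul_id_mul ((j : ℝ) + 1) (-1)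
        (hhM (s + 1) (by linarith)) using 1
      rw [Real.Gamma_add_one hs.ne']
      push_cast
      ring

/-- With a natural `n > m`, write `(r + 1) ^ m` as `(r + 1) ^ n * (r + 1) ^ (m - n)`; the last
factor is the `r`-th moment of `exp (-t)` under a Gamma density. The moment at `-s` exists because
`s < 1`. -/
theorem exists_hasRealMellin_rpow_mul_exp_series (m : ℝ) : ∃ g : ℝ → ℝ,
    (∀ y, HasSum (fun r : ℕ => ((r : ℝ) + 1) ^ m / r.factorial * (-y) ^ r) (g y)) ∧
    ∀ s : ℝ, 0 < s → s < 1 → HasRealMellin g s (Real.Gamma s * (1 - s) ^ m) := by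
  obtain ⟨n, hn⟩ := exists_nat_gt m
  obtain ⟨g, hgm, hgs, hgM⟩ := exists_hasRealMellin_natPow_mul_exp_series n 0
  have hd : 0 < n - m := sub_pos.2 hn
  have hG : Real.Gamma (n - m) ≠ 0 := (Real.Gamma_pos_of_pos hd).ne'
  let c : ℝ → ℝ := fun t => t ^ (n - m - 1) * Real.exp (-t) / Real.Gamma (n - m)
  have hcw : ∀ p t : ℝ, c t * Real.exp (-t) ^ p =
      t ^ (n - m - 1) * Real.exp (-((p + 1) * t)) / Real.Gamma (n - m) := fun p t => by
    have : Real.exp (-((p + 1) * t)) = Real.exp (-t) * Real.exp (-t) ^ p := by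
      rw [← Real.exp_mul, ← Real.exp_add]; ring_nf
    simp only [c, this]
    ring
  have hci : ∀ p : ℝ, 0 < p + 1 → IntegrableOn (fun t => c t * Real.exp (-t) ^ p) (Ioi 0) ∧
      ∫ t in Ioi 0, c t * Real.exp (-t) ^ p = (p + 1) ^ (m - n) := fun p hp => by
    simp only [hcw]
    refine ⟨(integrableOn_rpow_mul_exp_neg_mul hd hp).div_const _, ?_⟩
    rw [integral_div, Real.integral_rpow_mul_exp_neg_mul_Ioi hd hp, mul_div_assoc, div_self hG,
      mul_one, one_div, Real.inv_rpow hp.le, ← Real.rpow_neg hp.le, neg_sub]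
  refine ⟨fun y => ∫ t in Ioi 0, c t * g (y * Real.exp (-t)), fun y => ?_, fun s hs hs1 => ?_⟩
  · have hc : IntegrableOn c (Ioi 0) := by simpa using (hci 0 (by norm_num)).1
    have := hasSum_mul_integral_of_hasSum_pow (w := fun t => Real.exp (-t)) (x := -y)
      (g := fun u => g (-u)) hc (by fun_prop)
      ((ae_restrict_mem measurableSet_Ioi).mono fun t ht =>
        ⟨(Real.exp_pos _).le, Real.exp_le_one_iff.2 (neg_nonpos.2 (le_of_lt ht))⟩)
      (hgs (-y)).summable.abs (.of_forall fun t => hgs _)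
    simp only [neg_mul, neg_neg] at this
    refine this.congr_fun fun r => ?_
    have hr : (0 : ℝ) < r + 1 := by positivity
    have h2 := (hci r hr).2
    simp only [Real.rpow_natCast] at h2
    rw [h2, Real.rpow_sub hr, Real.rpow_natCast]
    push_cast
    field_simp
    ring
  · have := HasRealMellin.integral_mul_comp_mul (μ := volume.restrict (Ioi (0 : ℝ))) (c := c)
      (w := fun t => Real.exp (-t)) hgm (by fun_prop) (by fun_prop)
      (.of_forall fun t => Real.exp_pos _) (hgM s hs) (hci (-s) (by linarith)).1
    rw [(hci (-s) (by linarith)).2] at this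
    convert this using 1
    have h1 : 0 < 1 - s := sub_pos.2 hs1
    rw [neg_add_eq_sub, Real.rpow_sub h1, Real.rpow_natCast]
    push_cast
    rw [zero_add]
    field_simp

/-! ### The Möbius series and the coefficients `1 / ζ(2r + 2)`. -/

open ArithmeticFunction in
theorem hasSum_moebius_mul_rpow_neg (x : ℝ) (hx : 1 < x) :
    ∃ z : ℝ, HasSum (fun n : ℕ => (moebius n : ℝ) * (n : ℝ) ^ (-x)) z ∧
      (z : ℂ) = (riemannZeta x)⁻¹ := by
  have hx' : 1 < (x : ℂ).re := by simpa
  have e : ∀ n : ℕ, LSeries.term (fun n => ((moebius n : ℤ) : ℂ)) x n =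
      (((moebius n : ℝ) * (n : ℝ) ^ (-x) : ℝ) : ℂ) := fun n => by
    rcases eq_or_ne n 0 with rfl | hn
    · simp
    · rw [LSeries.term_of_ne_zero hn, Real.rpow_neg (Nat.cast_nonneg n)]
      push_cast
      rw [Complex.ofReal_cpow (Nat.cast_nonneg n), div_eq_mul_inv]
      simp
  have hS : Summable fun n : ℕ => (moebius n : ℝ) * (n : ℝ) ^ (-x) := by
    have := LSeriesSummable_moebius_iff.2 hx'
    simpa only [LSeriesSummable, funext e, Complex.summable_ofReal] using this
  refine ⟨_, hS.hasSum, ?_⟩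
  have h := LSeries_one_mul_Lseries_moebius hx'
  rw [LSeries_one_eq_riemannZeta hx'] at h
  rw [Complex.ofReal_tsum, ← tsum_congr e]
  exact eq_inv_of_mul_eq_one_right h

theorem integral_count_nat {f : ℕ → ℝ} (hf : Summable f) : ∫ n, f n ∂Measure.count = ∑' n, f n := by
  rw [integral_countable (integrable_count_iff.2 hf.norm)]
  simp

open ArithmeticFunction in
theorem exists_hasRealMellin_inv_zeta_exp_series : ∃ (g : ℝ → ℝ) (z : ℝ → ℝ),
    (∀ x, 1 < x → (z x : ℂ) = (riemannZeta x)⁻¹) ∧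
    (∀ y, HasSum (fun r : ℕ => z (2 * r + 2) / r.factorial * (-y) ^ r) (g y)) ∧
    ∀ s : ℝ, 0 < s → s < 1 / 2 → HasRealMellin g s (Real.Gamma s * z (2 - 2 * s)) := by
  choose! z hz hzeta using hasSum_moebius_mul_rpow_neg
  let c : ℕ → ℝ := fun n => moebius n * (n : ℝ) ^ (-2 : ℝ)
  -- `(0 : ℝ) ^ (-2 : ℝ)` is `0`, but dilations must be positive; the value at `0` is harmless since
  -- `moebius 0 = 0`.
  let w : ℕ → ℝ := fun n => if n = 0 then 1 else (n : ℝ) ^ (-2 : ℝ)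
  have hw0 : ∀ n, 0 < w n := fun n => by
    simp only [w]
    split_ifs with h
    · exact one_pos
    · exact Real.rpow_pos_of_pos (by positivity) _
  have hw1 : ∀ n, w n ≤ 1 := fun n => by
    simp only [w]
    split_ifs with h
    · exact le_rfl
    · exact Real.rpow_le_one_of_one_le_of_nonpos
        (by exact_mod_cast Nat.one_le_iff_ne_zero.2 h) (by norm_num)
  have hcw : ∀ (p : ℝ) (n : ℕ), c n * w n ^ p = moebius n * (n : ℝ) ^ (-(2 * p + 2)) := fun p n => by
    rcases eq_or_ne n 0 with rfl | hn
    · simp [c]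
    · have h0 : (0 : ℝ) < n := by positivity
      simp only [c, w, hn, if_false]
      rw [mul_assoc, ← Real.rpow_mul h0.le, ← Real.rpow_add h0]
      ring_nf
  have hci : ∀ p : ℝ, 1 < 2 * p + 2 → Integrable (fun n => c n * w n ^ p) Measure.count ∧
      ∫ n, c n * w n ^ p ∂Measure.count = z (2 * p + 2) := fun p hp => by
    simp only [hcw]
    have := hz _ hp
    exact ⟨integrable_count_iff.2 this.summable.norm,
      (integral_count_nat this.summable).trans this.tsum_eq⟩
  refine ⟨fun y => ∫ n, c n * Real.exp (-(y * w n)) ∂Measure.count, z, fun x hx => hzeta x hx,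
    fun y => ?_, fun s hs hs1 => ?_⟩
  · have hc : Integrable c Measure.count := by simpa using (hci 0 (by norm_num)).1
    have hexp : ∀ u : ℝ, HasSum (fun r : ℕ => ((r.factorial : ℝ))⁻¹ * u ^ r) (Real.exp u) :=
      fun u => by
        have := NormedSpace.expSeries_div_hasSum_exp (𝔸 := ℝ) u
        rw [← Real.exp_eq_exp_ℝ] at this
        refine this.congr_fun fun r => ?_
        ring
    have := hasSum_mul_integral_of_hasSum_pow (w := w) (x := -y) hc (by fun_prop)
      (.of_forall fun n => ⟨(hw0 n).le, hw1 n⟩) (hexp (-y)).summable.abs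
      (.of_forall fun n => hexp _)
    simp only [neg_mul] at this
    refine this.congr_fun fun r => ?_
    have h2 := (hci r (by have : (0:ℝ) ≤ r := r.cast_nonneg; linarith)).2
    simp only [Real.rpow_natCast] at h2
    rw [h2]
    ring
  · have h := hci (-s) (by linarith)
    have := HasRealMellin.integral_mul_comp_mul (μ := Measure.count) (c := c) (w := w)
      (g := fun y => Real.exp (-y)) (by fun_prop) (by fun_prop) (by fun_prop)
      (.of_forall hw0) (hasRealMellin_exp_neg hs) h.1
    rw [h.2] at this
    convert this using 3
    ring

/-! ### Euler's integral for the hypergeometric function, `0 < b < c`. -/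

theorem integral_rpow_mul_one_sub_rpow {u v : ℝ} (hu : 0 < u) (hv : 0 < v) :
    IntegrableOn (fun t : ℝ => t ^ (u - 1) * (1 - t) ^ (v - 1)) (Ioo 0 1) ∧
      ∫ t in Ioo (0 : ℝ) 1, t ^ (u - 1) * (1 - t) ^ (v - 1) =
        Real.Gamma u * Real.Gamma v / Real.Gamma (u + v) := by
  have e : EqOn (fun t : ℝ => ((t : ℂ) ^ ((u : ℂ) - 1) * (1 - (t : ℂ)) ^ ((v : ℂ) - 1)))
      (fun t => ((t ^ (u - 1) * (1 - t) ^ (v - 1) : ℝ) : ℂ)) (Ioo 0 1) := fun t ht => by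
    simp only [Complex.ofReal_mul]
    rw [Complex.ofReal_cpow ht.1.le, Complex.ofReal_cpow (sub_nonneg.2 ht.2.le)]
    push_cast
    rfl
  have hi := Complex.betaIntegral_convergent (u := u) (v := v) (by simpa) (by simpa)
  rw [intervalIntegrable_iff_integrableOn_Ioo_of_le zero_le_one] at hi
  have hi' := hi.congr_fun e measurableSet_Ioo
  refine ⟨by simpa [IntegrableOn] using hi'.re, ?_⟩
  have h := Complex.betaIntegral_eq_Gamma_mul_div u v (by simpa) (by simpa)
  rw [Complex.betaIntegral, intervalIntegral.integral_of_le zero_le_one,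
    integral_Ioc_eq_integral_Ioo, setIntegral_congr_fun measurableSet_Ioo e,
    integral_complex_ofReal, ← Complex.ofReal_add, Complex.Gamma_ofReal, Complex.Gamma_ofReal,
    Complex.Gamma_ofReal] at h
  exact_mod_cast h

theorem Real.Gamma_add_nat_eq_ascPochhammer_mul {x : ℝ} (hx : 0 < x) (n : ℕ) :
    Real.Gamma (x + n) = (ascPochhammer ℝ n).eval x * Real.Gamma x := by
  induction n with
  | zero => simp
  | succ n ih =>
    rw [Nat.cast_succ, ← add_assoc, Real.Gamma_add_one (by positivity), ih,
      ascPochhammer_succ_eval]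
    ring

theorem hasSum_one_sub_rpow_neg (a : ℝ) {x : ℝ} (hx : |x| < 1) :
    HasSum (fun n : ℕ => (ascPochhammer ℝ n).eval a / n.factorial * x ^ n) ((1 - x) ^ (-a)) := by
  have h := (Real.one_div_one_sub_rpow_hasFPowerSeriesOnBall_zero a).hasSum (y := x)
    (by simpa [enorm_eq_nnnorm, ← NNReal.coe_lt_coe] using hx)
  have h1 : 0 ≤ 1 - x := by linarith [le_abs_self x]
  rw [zero_add, one_div, ← Real.rpow_neg h1] at h
  refine h.congr_fun fun n => ?_
  have h2 : (n.factorial : ℝ) * Ring.choose (a + n - 1) n = (ascPochhammer ℝ n).eval a := by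
    have := Ring.factorial_nsmul_multichoose_eq_ascPochhammer a n
    rw [Polynomial.ascPochhammer_smeval_eq_eval, nsmul_eq_mul] at this
    rw [← this, Ring.choose]
    congr 2
    ring
  have : (n.factorial : ℝ) ≠ 0 := by positivity
  rw [← h2, FormalMultilinearSeries.ofScalars_apply_eq, smul_eq_mul]
  field_simp

theorem norm_one_sub_mul_cpow_le {q : ℝ} (hq : q < 1) {z : ℂ} (hz : z.re < q) {t : ℝ}
    (ht : t ∈ Ioo (0 : ℝ) 1) {p : ℝ} (hp : p ≤ 0) :
    1 - max q 0 ≤ (1 - z * t).re ∧ ‖(1 - z * t) ^ (p : ℂ)‖ ≤ (1 - max q 0) ^ p := by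
  -- The maximum with `0` makes the bound uniform in `t`: for `q < 0`, `q * t` may be close to `0`.
  have hδ : 0 < 1 - max q 0 := sub_pos.2 (max_lt hq one_pos)
  have h1 : 1 - max q 0 ≤ (1 - z * t).re := by
    simp only [Complex.sub_re, Complex.one_re, Complex.re_mul_ofReal]
    have h2 : z.re * t ≤ max q 0 * t :=
      mul_le_mul_of_nonneg_right (hz.le.trans (le_max_left _ _)) ht.1.le
    have h3 : max q 0 * t ≤ max q 0 := mul_le_of_le_one_right (le_max_right _ _) ht.2.le
    linarith
  refine ⟨h1, ?_⟩
  rw [Complex.norm_cpow_real]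
  exact Real.rpow_le_rpow_of_nonpos hδ (h1.trans (Complex.re_le_norm _)) hp

theorem differentiableOn_integral_mul_one_sub_mul_cpow {c : ℝ → ℝ} (hc : Measurable c)
    (hci : IntegrableOn c (Ioo 0 1)) {a : ℝ} (ha : 0 < a) :
    DifferentiableOn ℂ (fun z => ∫ t in Ioo (0 : ℝ) 1, (c t : ℂ) * (1 - z * t) ^ ((-a : ℝ) : ℂ))
      {z | z.re < 1} := by
  intro z₀ hz₀
  obtain ⟨q, hzq, hq⟩ := exists_between (show z₀.re < 1 from hz₀)
  have hopen : {z : ℂ | z.re < q} ∈ nhds z₀ :=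
    (isOpen_lt Complex.continuous_re continuous_const).mem_nhds hzq
  refine ((hasDerivAt_integral_of_dominated_loc_of_deriv_le (s := {z : ℂ | z.re < q})
    (μ := volume.restrict (Ioo (0 : ℝ) 1))
    (F' := fun z t => (c t : ℂ) *
      (((-a : ℝ) : ℂ) * (1 - z * t) ^ ((-a - 1 : ℝ) : ℂ) * (-(t : ℂ))))
    (bound := fun t => |c t| * (a * (1 - max q 0) ^ (-a - 1))) hopen
    (.of_forall fun z => ?_) ?_ ?_ ?_ ?_ ?_).2.differentiableAt).differentiableWithinAt
  · exact Measurable.aestronglyMeasurable (by fun_prop)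
  · refine (hci.abs.mul_const ((1 - max q 0) ^ (-a))).mono'
      (Measurable.aestronglyMeasurable (by fun_prop)) ?_
    filter_upwards [ae_restrict_mem measurableSet_Ioo] with t ht
    rw [norm_mul, Complex.norm_real, Real.norm_eq_abs]
    exact mul_le_mul_of_nonneg_left
      (norm_one_sub_mul_cpow_le hq hzq ht (neg_nonpos.2 ha.le)).2 (abs_nonneg _)
  · exact Measurable.aestronglyMeasurable (by fun_prop)
  · filter_upwards [ae_restrict_mem measurableSet_Ioo] with t ht z hz
    have h := (norm_one_sub_mul_cpow_le hq hz ht (p := -a - 1) (by linarith)).2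
    rw [norm_mul, norm_mul, norm_mul, norm_neg, Complex.norm_real, Complex.norm_real,
      Complex.norm_real, Real.norm_eq_abs, Real.norm_eq_abs, Real.norm_eq_abs, abs_neg,
      abs_of_pos ha, abs_of_pos ht.1]
    refine mul_le_mul_of_nonneg_left ?_ (abs_nonneg _)
    calc a * ‖(1 - z * t) ^ ((-a - 1 : ℝ) : ℂ)‖ * t ≤ a * ‖(1 - z * t) ^ ((-a - 1 : ℝ) : ℂ)‖ :=
          mul_le_of_le_one_right (by positivity) ht.2.le
      _ ≤ _ := mul_le_mul_of_nonneg_left h ha.le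
  · exact hci.abs.mul_const _
  · filter_upwards [ae_restrict_mem measurableSet_Ioo] with t ht z hz
    have h := (norm_one_sub_mul_cpow_le hq hz ht (p := -a - 1) (by linarith)).1
    have hδ : 0 < 1 - max q 0 := sub_pos.2 (max_lt hq one_pos)
    have h1 : HasDerivAt (fun z : ℂ => 1 - z * t) (-(t : ℂ)) z := by
      simpa using ((hasDerivAt_id z).mul_const (t : ℂ)).const_sub 1
    have h2 := (h1.cpow_const (c := ((-a : ℝ) : ℂ))
      (Or.inl (hδ.trans_le h))).const_mul (c t : ℂ)
    rwa [← Complex.ofReal_one, ← Complex.ofReal_sub (-a), Complex.ofReal_one] at h2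

/-- Real analyticity comes from holomorphy on `re z < 1`, where differentiating once under the
integral suffices. -/
theorem analyticOnNhd_integral_mul_one_sub_mul_rpow {c : ℝ → ℝ} (hc : Measurable c)
    (hci : IntegrableOn c (Ioo 0 1)) {a : ℝ} (ha : 0 < a) :
    AnalyticOnNhd ℝ (fun x => ∫ t in Ioo (0 : ℝ) 1, c t * (1 - x * t) ^ (-a)) (Iio 1) := by
  let G : ℂ → ℂ := fun z => ∫ t in Ioo (0 : ℝ) 1, (c t : ℂ) * (1 - z * t) ^ ((-a : ℝ) : ℂ)
  have hG : AnalyticOnNhd ℂ G {z | z.re < 1} :=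
    (differentiableOn_integral_mul_one_sub_mul_cpow hc hci ha).analyticOnNhd
      (isOpen_lt Complex.continuous_re continuous_const)
  intro x hx
  have hx' : (x : ℂ) ∈ {z : ℂ | z.re < 1} := by simpa using hx
  have h1 : AnalyticAt ℝ (fun y : ℝ => (G (y : ℂ)).re) x :=
    (Complex.reCLM.analyticAt _).comp
      (AnalyticAt.comp (f := fun y : ℝ => (y : ℂ)) ((hG _ hx').restrictScalars (𝕜 := ℝ))
        (Complex.ofRealCLM.analyticAt x))
  refine h1.congr ?_
  filter_upwards [isOpen_Iio.mem_nhds hx] with y hy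
  have e : EqOn (fun t : ℝ => (c t : ℂ) * (1 - (y : ℂ) * t) ^ ((-a : ℝ) : ℂ))
      (fun t => ((c t * (1 - y * t) ^ (-a) : ℝ) : ℂ)) (Ioo 0 1) := fun t ht => by
    have hy : y < 1 := hy
    have : 0 ≤ 1 - y * t := by nlinarith [ht.1, ht.2]
    simp only [Complex.ofReal_mul]
    rw [Complex.ofReal_cpow this]
    push_cast
    rfl
  simp only [G]
  rw [setIntegral_congr_fun measurableSet_Ioo e, integral_complex_ofReal, Complex.ofReal_re]

/-- In reciprocal form the recursion needs no exception at the poles, where `Real.Gamma` is `0`;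
this matters because `c - s` may be a pole. -/
theorem Real.inv_Gamma_eq_self_mul_inv_Gamma_add_one (x : ℝ) :
    (Real.Gamma x)⁻¹ = x * (Real.Gamma (x + 1))⁻¹ := by
  rcases eq_or_ne x 0 with rfl | hx
  · simp
  · rw [Real.Gamma_add_one hx]
    field_simp

/-- Under the Beta density `ρ` the moments of `t` are `(b)_n / (c)_n`, which turns the binomial
series of `(1 - x) ^ (-a)` into the Gauss series. -/
theorem exists_isGaussContinuation_hasRealMellin_of_lt {a b c : ℝ} (ha : 0 < a) (hb : 0 < b)
    (hbc : b < c) : ∃ F, IsGaussContinuation a b c F ∧ ∀ s, 0 < s → s < a → s < b →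
      HasRealMellin (fun y => F (-y)) s (Real.Gamma s *
        (Real.Gamma c / (Real.Gamma a * Real.Gamma b)) *
          (Real.Gamma (a - s) * Real.Gamma (b - s) / Real.Gamma (c - s))) := by
  have hd : 0 < c - b := sub_pos.2 hbc
  have hGb := (Real.Gamma_pos_of_pos hb).ne'
  have hGc := (Real.Gamma_pos_of_pos (hb.trans hbc)).ne'
  have hGd := (Real.Gamma_pos_of_pos hd).ne'
  let κ : ℝ := Real.Gamma c / (Real.Gamma b * Real.Gamma (c - b))
  let ρ : ℝ → ℝ := fun t => κ * (t ^ (b - 1) * (1 - t) ^ (c - b - 1))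
  have hρ : ∀ p : ℝ, 0 < b + p → IntegrableOn (fun t => ρ t * t ^ p) (Ioo 0 1) ∧
      ∫ t in Ioo (0 : ℝ) 1, ρ t * t ^ p =
        κ * (Real.Gamma (b + p) * Real.Gamma (c - b) / Real.Gamma (c + p)) := fun p hp => by
    have e : EqOn (fun t => κ * (t ^ (b + p - 1) * (1 - t) ^ (c - b - 1)))
        (fun t => ρ t * t ^ p) (Ioo 0 1) := fun t ht => by
      have : t ^ (b + p - 1) = t ^ (b - 1) * t ^ p := by rw [← Real.rpow_add ht.1]; ring_nf
      simp only [ρ, this]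
      ring
    have h := integral_rpow_mul_one_sub_rpow hp hd
    refine ⟨IntegrableOn.congr_fun (h.1.const_mul κ) e measurableSet_Ioo, ?_⟩
    rw [← setIntegral_congr_fun measurableSet_Ioo e, integral_const_mul, h.2,
      show b + p + (c - b) = c + p by ring]
  have hρi : IntegrableOn ρ (Ioo 0 1) := by simpa using (hρ 0 (by simpa)).1
  have hρm : Measurable ρ := by fun_prop
  refine ⟨fun x => ∫ t in Ioo (0 : ℝ) 1, ρ t * (1 - x * t) ^ (-a),
    ⟨analyticOnNhd_integral_mul_one_sub_mul_rpow hρm hρi ha, fun x hx => ?_⟩,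
    fun s hs hsa hsb => ?_⟩
  · have hx1 : |x| < 1 := abs_lt.2 hx
    have h := hasSum_mul_integral_of_hasSum_pow (μ := volume.restrict (Ioo (0 : ℝ) 1))
      (w := fun t => t) (x := x) (g := fun u => (1 - u) ^ (-a)) hρi (by fun_prop)
      ((ae_restrict_mem measurableSet_Ioo).mono fun t ht => ⟨ht.1.le, ht.2.le⟩)
      (hasSum_one_sub_rpow_neg a hx1).summable.abs
      ((ae_restrict_mem measurableSet_Ioo).mono fun t ht => hasSum_one_sub_rpow_neg a (by
        rw [abs_mul, abs_of_pos ht.1]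
        exact (mul_le_of_le_one_right (abs_nonneg _) ht.2.le).trans_lt hx1))
    refine h.congr_fun fun n => ?_
    have h2 := (hρ n (by positivity)).2
    simp only [Real.rpow_natCast] at h2
    have hp := ascPochhammer_pos n c (hb.trans hbc)
    rw [h2, Real.Gamma_add_nat_eq_ascPochhammer_mul hb,
      Real.Gamma_add_nat_eq_ascPochhammer_mul (hb.trans hbc)]
    simp only [κ]
    field_simp
  · have hM := HasRealMellin.integral_mul_comp_mul (μ := volume.restrict (Ioo (0 : ℝ) 1))
      (c := ρ) (w := fun t => t) (g := fun u => (1 + u) ^ (-a)) (by fun_prop) hρm (by fun_prop)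
      ((ae_restrict_mem measurableSet_Ioo).mono fun t ht => ht.1)
      (hasRealMellin_one_add_rpow_neg hs hsa) (hρ (-s) (by linarith)).1
    rw [(hρ (-s) (by linarith)).2] at hM
    simp only [neg_mul, sub_neg_eq_add]
    convert hM using 1
    simp only [κ, ← sub_eq_add_neg]
    field_simp

/-! ### Removing the restriction `b < c`. -/

/-- Coefficientwise, `1 / (c)_n = (1 + n / c) / (c + 1)_n`; the term with `n` becomes `x * F₂ x`
after an index shift. -/
theorem IsGaussContinuation.contiguous {a b c : ℝ} (hc : ∀ n : ℕ, c ≠ -(n : ℝ)) {F₁ F₂ : ℝ → ℝ}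
    (h₁ : IsGaussContinuation a b (c + 1) F₁)
    (h₂ : IsGaussContinuation (a + 1) (b + 1) (c + 1 + 1) F₂) :
    IsGaussContinuation a b c (fun x => F₁ x + a * b / (c * (c + 1)) * (x * F₂ x)) := by
  refine ⟨h₁.1.add (analyticOnNhd_const.mul (analyticOnNhd_id.mul h₂.1)), fun x hx => ?_⟩
  have hc' : ∀ n : ℕ, c + n ≠ 0 := fun n h => hc n (by linarith)
  have hleft : ∀ (n : ℕ) (y : ℝ),
      (ascPochhammer ℝ (n + 1)).eval y = y * (ascPochhammer ℝ n).eval (y + 1) := fun n y => by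
    simp [ascPochhammer_succ_left, Polynomial.eval_comp]
  have hne : ∀ n : ℕ, (ascPochhammer ℝ n).eval c ≠ 0 := fun n h => by
    obtain ⟨k, -, hk⟩ := (ascPochhammer_eval_eq_zero_iff n c).1 h
    exact hc k (by linarith)
  refine (HasSum.add (h₁.2 x hx) (g := fun n : ℕ => (n : ℝ) / c *
    ((ascPochhammer ℝ n).eval a * (ascPochhammer ℝ n).eval b /
      (ascPochhammer ℝ n).eval (c + 1) * (x ^ n / n.factorial))) ?_).congr_fun fun n => ?_
  · rw [← hasSum_nat_add_iff' 1]
    simp only [Finset.sum_range_one, Nat.cast_zero, zero_div, zero_mul, sub_zero]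
    refine (((h₂.2 x hx).mul_left x).mul_left (a * b / (c * (c + 1)))).congr_fun fun n => ?_
    have : (n.factorial : ℝ) ≠ 0 := by positivity
    rw [hleft, hleft, hleft, Nat.factorial_succ]
    push_cast
    have h3 : (n : ℝ) + 1 ≠ 0 := by positivity
    have h4 : c ≠ 0 := by simpa using hc' 0
    have h5 : c + 1 ≠ 0 := by simpa using hc' 1
    field_simp
    ring
  · have h4 : c ≠ 0 := by simpa using hc' 0
    have h6 := hleft n c
    rw [ascPochhammer_succ_eval] at h6
    have h7 : (ascPochhammer ℝ n).eval (c + 1) = (ascPochhammer ℝ n).eval c * (c + n) / c := by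
      rw [h6]; field_simp
    have h8 := hc' n
    have h9 := hne n
    have : (n.factorial : ℝ) ≠ 0 := by positivity
    rw [h7]
    field_simp

/-- Both functions in the contiguous relation have `c - b` larger by one, so finitely many steps
reach Euler's case. -/
theorem exists_isGaussContinuation_hasRealMellin (n : ℕ) : ∀ {a b c : ℝ}, 0 < a → 0 < b →
    (∀ k : ℕ, c ≠ -(k : ℝ)) → b < c + n →
      ∃ F, IsGaussContinuation a b c F ∧ ∀ s, 0 < s → s < a → s < b →
        HasRealMellin (fun y => F (-y)) s (Real.Gamma s *
          (Real.Gamma c / (Real.Gamma a * Real.Gamma b)) *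
            (Real.Gamma (a - s) * Real.Gamma (b - s) / Real.Gamma (c - s))) := by
  induction n with
  | zero =>
    intro a b c ha hb _ hbc
    exact exists_isGaussContinuation_hasRealMellin_of_lt ha hb (by simpa using hbc)
  | succ n ih =>
    intro a b c ha hb hc hbc
    have hc1 : ∀ k : ℕ, c + 1 ≠ -(k : ℝ) := fun k h => hc (k + 1) (by push_cast; linarith)
    have hc2 : ∀ k : ℕ, c + 1 + 1 ≠ -(k : ℝ) := fun k h => hc1 (k + 1) (by push_cast; linarith)
    push_cast at hbc
    obtain ⟨F₁, h₁, hM₁⟩ := ih ha hb hc1 (by linarith)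
    obtain ⟨F₂, h₂, hM₂⟩ := ih (a := a + 1) (b := b + 1) (by linarith) (by linarith) hc2
      (by linarith)
    refine ⟨_, h₁.contiguous hc h₂, fun s hs hsa hsb => ?_⟩
    have h0 : c ≠ 0 := by simpa using hc 0
    have h01 : c + 1 ≠ 0 := by simpa using hc1 0
    have hGa := (Real.Gamma_pos_of_pos ha).ne'
    have hGb := (Real.Gamma_pos_of_pos hb).ne'
    have key := (hM₁ s hs hsa hsb).const_mul_add_const_mul_id_mul 1 (-(a * b / (c * (c + 1))))
      (hM₂ (s + 1) (by linarith) (by linarith) (by linarith))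
    convert key using 1
    · funext y; ring
    · rw [show a + 1 - (s + 1) = a - s by ring, show b + 1 - (s + 1) = b - s by ring,
        show c + 1 + 1 - (s + 1) = c - s + 1 by ring, show c + 1 - s = c - s + 1 by ring,
        Real.Gamma_add_one h01, Real.Gamma_add_one h0, Real.Gamma_add_one hs.ne',
        Real.Gamma_add_one ha.ne', Real.Gamma_add_one hb.ne', div_eq_mul_inv _ (Real.Gamma (c - s)),
        Real.inv_Gamma_eq_self_mul_inv_Gamma_add_one, div_eq_mul_inv _ (Real.Gamma (c - s + 1))]
      -- This factor may vanish, so it stays an opaque common factor; what remains amounts to the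
      -- coefficient identity `c - s = c * 1 - s`.
      generalize (Real.Gamma (c - s + 1))⁻¹ = u
      field_simp
      ring

/-! ### Uniqueness of the continuation, and transfer to `gaussF`. -/

theorem IsGaussContinuation.eqOn {a b c : ℝ} {F G : ℝ → ℝ} (hF : IsGaussContinuation a b c F)
    (hG : IsGaussContinuation a b c G) : EqOn F G (Iio 1) := by
  refine hF.1.eqOn_of_preconnected_of_eventuallyEq hG.1 isPreconnected_Iio
    (mem_Iio.2 (one_pos : (0 : ℝ) < 1)) ?_
  filter_upwards [Ioo_mem_nhds (show (-1 : ℝ) < 0 by norm_num) (one_pos : (0 : ℝ) < 1)] with x hx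
  exact (hF.2 x hx).unique (hG.2 x hx)

theorem isGaussContinuation_gaussF {a b c : ℝ} {F : ℝ → ℝ} (hF : IsGaussContinuation a b c F) :
    IsGaussContinuation a b c (gaussF a b c) := by
  have h : ∃ F, IsGaussContinuation a b c F := ⟨F, hF⟩
  rw [gaussF, dif_pos h]
  exact Classical.choose_spec h

theorem hasRealMellin_gaussF {a b c s : ℝ} (ha : 0 < a) (hb : 0 < b)
    (hc : ∀ k : ℕ, c ≠ -(k : ℝ)) (hs : 0 < s) (hsa : s < a) (hsb : s < b) :
    IsGaussContinuation a b c (gaussF a b c) ∧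
      HasRealMellin (fun y => gaussF a b c (-y)) s (Real.Gamma s *
        (Real.Gamma c / (Real.Gamma a * Real.Gamma b)) *
          (Real.Gamma (a - s) * Real.Gamma (b - s) / Real.Gamma (c - s))) := by
  obtain ⟨n, hn⟩ := exists_nat_gt (b - c)
  obtain ⟨F, hF, hM⟩ := exists_isGaussContinuation_hasRealMellin n ha hb hc (by linarith)
  have hgF := isGaussContinuation_gaussF hF
  refine ⟨hgF, (hM s hs hsa hsb).congr fun y hy => hF.eqOn hgF ?_⟩
  have hy : 0 < y := hy
  exact show -y < 1 by linarith

/-! ### Return to general `k`. -/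

theorem neg_rpow_div_pow {k x : ℝ} (hx : 0 < x) (r : ℕ) :
    (-(x ^ k / k)) ^ r = (-1) ^ r * x ^ (k * (r : ℝ)) / k ^ r := by
  rw [neg_pow, div_pow, ← Real.rpow_mul_natCast hx.le, mul_div_assoc]

end

theorem theorem2p2 (k : ℝ) (hk : 0 < k) :
    -- (i)
    (∀ α β γ s : ℝ, (∀ n : ℕ, γ ≠ -(n : ℝ)) → 0 < s → s / k < min α β →
      IsGaussContinuation α β γ (gaussF α β γ) ∧
      MeasureTheory.IntegrableOn
        (fun x : ℝ => x ^ (s - 1) * gaussF α β γ (-(x ^ k / k))) (Set.Ioi 0) ∧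
      ∫ x in Set.Ioi (0 : ℝ), x ^ (s - 1) * gaussF α β γ (-(x ^ k / k)) =
        k ^ (s / k - 1) * Real.Gamma (s / k) *
          (Real.Gamma γ / (Real.Gamma α * Real.Gamma β)) *
          (Real.Gamma (α - s / k) * Real.Gamma (β - s / k) / Real.Gamma (γ - s / k))) ∧
    -- (ii)
    (∀ m s : ℝ, 0 < s → s / k < 1 →
      (∀ x : ℝ, 0 < x → Summable (fun r : ℕ =>
        ((r : ℝ) + 1) ^ m * (-1) ^ r * x ^ (k * (r : ℝ)) / ((r.factorial : ℝ) * k ^ r))) ∧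
      MeasureTheory.IntegrableOn
        (fun x : ℝ => x ^ (s - 1) * ∑' r : ℕ,
          ((r : ℝ) + 1) ^ m * (-1) ^ r * x ^ (k * (r : ℝ)) / ((r.factorial : ℝ) * k ^ r))
        (Set.Ioi 0) ∧
      ∫ x in Set.Ioi (0 : ℝ), x ^ (s - 1) * ∑' r : ℕ,
          ((r : ℝ) + 1) ^ m * (-1) ^ r * x ^ (k * (r : ℝ)) / ((r.factorial : ℝ) * k ^ r) =
        k ^ (s / k - 1) * Real.Gamma (s / k) * (1 - s / k) ^ m) ∧
    -- (iii)
    (∀ s : ℝ, 0 < s → s / k < 1 / 2 →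
      (∀ x : ℝ, 0 < x → Summable (fun r : ℕ =>
        (((-1) ^ r * x ^ (k * (r : ℝ)) : ℝ) : ℂ) /
          (((r.factorial : ℝ) * k ^ r : ℝ) * riemannZeta (2 * (r : ℂ) + 2)))) ∧
      MeasureTheory.IntegrableOn
        (fun x : ℝ => ((x ^ (s - 1) : ℝ) : ℂ) * ∑' r : ℕ,
          (((-1) ^ r * x ^ (k * (r : ℝ)) : ℝ) : ℂ) /
            (((r.factorial : ℝ) * k ^ r : ℝ) * riemannZeta (2 * (r : ℂ) + 2)))
        (Set.Ioi 0) ∧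
      ∫ x in Set.Ioi (0 : ℝ), ((x ^ (s - 1) : ℝ) : ℂ) * ∑' r : ℕ,
          (((-1) ^ r * x ^ (k * (r : ℝ)) : ℝ) : ℂ) /
            (((r.factorial : ℝ) * k ^ r : ℝ) * riemannZeta (2 * (r : ℂ) + 2)) =
        ((k ^ (s / k - 1) * Real.Gamma (s / k) : ℝ) : ℂ) /
          riemannZeta (2 - 2 * (s : ℂ) / (k : ℂ))) ∧
    -- (iv)
    (∀ m s : ℝ, 0 < s → s / k < m →
      MeasureTheory.IntegrableOn
        (fun x : ℝ => x ^ (s - 1) * (1 + x ^ k / k) ^ (-m)) (Set.Ioi 0) ∧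
      ∫ x in Set.Ioi (0 : ℝ), x ^ (s - 1) * (1 + x ^ k / k) ^ (-m) =
        k ^ (s / k - 1) * Real.Gamma (s / k) * Real.Gamma (m - s / k) / Real.Gamma m) := by
  refine ⟨fun α β γ s hγ hs hsk => ?_, fun m s hs hsk => ?_, fun s hs hsk => ?_,
    fun m s hs hsk => ?_⟩
  all_goals have hs' : 0 < s / k := div_pos hs hk
  · obtain ⟨hsα, hsβ⟩ := lt_min_iff.1 hsk
    obtain ⟨hF, hM⟩ := hasRealMellin_gaussF (hs'.trans hsα) (hs'.trans hsβ) hγ hs' hsα hsβ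
    have h := hM.comp_rpow_div hk
    refine ⟨hF, h.1, h.2.trans ?_⟩
    ring
  · obtain ⟨g, hg, hM⟩ := exists_hasRealMellin_rpow_mul_exp_series m
    have hsum : ∀ x : ℝ, 0 < x → HasSum (fun r : ℕ =>
        ((r : ℝ) + 1) ^ m * (-1) ^ r * x ^ (k * (r : ℝ)) / ((r.factorial : ℝ) * k ^ r))
        (g (x ^ k / k)) := fun x hx => (hg (x ^ k / k)).congr_fun fun r => by
      rw [neg_rpow_div_pow hx]
      field_simp
    have h := ((hM (s / k) hs' hsk).comp_rpow_div hk).congr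
      (g := fun x => ∑' r : ℕ,
        ((r : ℝ) + 1) ^ m * (-1) ^ r * x ^ (k * (r : ℝ)) / ((r.factorial : ℝ) * k ^ r))
      fun x hx => (hsum x hx).tsum_eq.symm
    exact ⟨fun x hx => (hsum x hx).summable, h.1, h.2.trans (by ring)⟩
  · obtain ⟨g, z, hz, hg, hM⟩ := exists_hasRealMellin_inv_zeta_exp_series
    have hsum : ∀ x : ℝ, 0 < x → HasSum (fun r : ℕ =>
        (((-1) ^ r * x ^ (k * (r : ℝ)) : ℝ) : ℂ) /
          (((r.factorial : ℝ) * k ^ r : ℝ) * riemannZeta (2 * (r : ℂ) + 2)))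
        ((g (x ^ k / k) : ℝ) : ℂ) := fun x hx => by
      refine (Complex.hasSum_ofReal.2 (hg (x ^ k / k))).congr_fun fun r => ?_
      have h2 := hz (2 * r + 2) (by have : (0 : ℝ) ≤ r := r.cast_nonneg; linarith)
      push_cast at h2
      rw [neg_rpow_div_pow hx, div_mul_eq_div_div, div_eq_mul_inv _ (riemannZeta _), ← h2,
        ← Complex.ofReal_div, ← Complex.ofReal_mul]
      congr 1
      field_simp
    have h := (hM (s / k) hs' hsk).comp_rpow_div hk
    -- `riemannZeta` is complex-valued, but here the integrand is the cast of a real function.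
    have e : Set.EqOn (fun x : ℝ => ((x ^ (s - 1) * g (x ^ k / k) : ℝ) : ℂ))
        (fun x : ℝ => ((x ^ (s - 1) : ℝ) : ℂ) * ∑' r : ℕ,
          (((-1) ^ r * x ^ (k * (r : ℝ)) : ℝ) : ℂ) /
            (((r.factorial : ℝ) * k ^ r : ℝ) * riemannZeta (2 * (r : ℂ) + 2))) (Set.Ioi 0) :=
      fun x hx => by
        beta_reduce
        rw [(hsum x hx).tsum_eq, Complex.ofReal_mul]
    refine ⟨fun x hx => (hsum x hx).summable,
      MeasureTheory.IntegrableOn.congr_fun h.1.ofReal e measurableSet_Ioi, ?_⟩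
    have hz' := hz (2 - 2 * (s / k)) (by linarith)
    rw [← MeasureTheory.setIntegral_congr_fun measurableSet_Ioi e, integral_complex_ofReal, h.2,
      show 2 - 2 * (s : ℂ) / (k : ℂ) = ((2 - 2 * (s / k) : ℝ) : ℂ) by push_cast; ring,
      div_eq_mul_inv _ (riemannZeta _), ← hz',
      ← Complex.ofReal_mul]
    congr 1
    ring
  · have h := (hasRealMellin_one_add_rpow_neg hs' hsk).comp_rpow_div hk
    exact ⟨h.1, h.2.trans (by ring)⟩
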